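/- Let $n,\theta$ be natural numbers with $\theta<n(n-1)$. Let $f:[n]\times[\theta]\to[n]$ be generic: for all $x_1\neq x_2$ and all $y$ in $[n]$, $\{e: f(x_1,e)=y\}\neq\{e: f(x_2,e)=y\}$, and for all $x,y\in[n]$, $\{e: f(x,e)=y\}\neq\emptyset$. Let $\mathcal A$ be an algorithm that, given any probability distributions $p_1,\dots,p_n$ on $[n]$, outputs a random variable $E$ with a finite number $|E|$ of states (its distribution) and functions $f_1,\dots,f_n$ into $[n]$ such that $f_i(E)$ has distribution $p_i$ for every $i$, where $|E|$ is the minimum possible. Consider a causal pair of random variables $X,Y$, each with $n$ states, whose true causal direction is either $X\to Y$, i.e. $Y=f(X,E_0)$ with $E_0$ independent of $X$, or $Y\to X$, i.e. $X=f(Y,E_0)$ with $E_0$ independent of $Y$; the exogenous variable $E_0$ has $\theta$ states. Suppose that the distributions of the cause ($X$ in the first case, $Y$ in the second) and of $E_0$ are drawn independently and uniformly at random from the $(n-1)$- and $(\theta-1)$-dimensional probability simplices. Given the joint distribution of $(X,Y)$, apply $\mathcal A$ to the conditional distributions $\{P(Y=\cdot\mid X=i)\}_{i\in[n]}$ to obtain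 $E$, and to $\{P(X=\cdot\mid Y=i)\}_{i\in[n]}$ to obtain $\tilde E$; declare $X\to Y$ if $|E|<|\tilde E|$ and $Y\to X$ if $|\tilde E|<|E|$. Then, with probability $1$, a direction is declared and it is the true causal direction. -/

import Mathlib

open MeasureTheory
open scoped NNReal ENNReal

noncomputable section

/-- The probability simplex of dimension `n - 1`, as a subset of Euclidean space `ℝⁿ`: the set of
all probability distributions on `n` states. -/
def probSimplex (n : ℕ) : Set (EuclideanSpace ℝ (Fin n)) :=
  {v | (fun i => v i) ∈ stdSimplex ℝ (Fin n)}

/-- The uniform distribution on the simplex: the normalized `(n - 1)`-dimensional Hausdorff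
(surface) measure of Euclidean space on it. -/
def uniformSimplex (n : ℕ) : Measure (EuclideanSpace ℝ (Fin n)) :=
  ProbabilityTheory.cond (Measure.hausdorffMeasure ((n : ℝ) - 1)) (probSimplex n)

/-- For at least one state the uniform distribution is a probability measure: the surface measure
of the simplex is positive and finite. -/
theorem uniformSimplex_isProbabilityMeasure (n : ℕ) (hn : n ≠ 0) :
    IsProbabilityMeasure (uniformSimplex n) := by
  obtain ⟨m, rfl⟩ := Nat.exists_eq_succ_of_ne_zero hn
  have hd : ((m.succ : ℕ) : ℝ) - 1 = (m : ℝ) := by push_cast; ring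
  have hvol : (Measure.hausdorffMeasure (m : ℝ) : Measure (Fin m → ℝ)) = volume := by
    simpa using hausdorffMeasure_pi_real (ι := Fin m)
  unfold uniformSimplex
  rw [hd]
  refine ProbabilityTheory.cond_isProbabilityMeasure_of_finite ?_ ?_
  · -- the projection that drops the first coordinate
    let L : EuclideanSpace ℝ (Fin m.succ) →ₗ[ℝ] (Fin m → ℝ) :=
      { toFun := fun v i => v i.succ
        map_add' := fun _ _ => rfl
        map_smul' := fun _ _ => rfl }
    have hL : LipschitzWith ‖L.toContinuousLinearMap‖₊ L := L.toContinuousLinearMap.lipschitz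
    have h1 := (hL.lipschitzOnWith (s := probSimplex m.succ)).hausdorffMeasure_image_le
      (d := (m : ℝ)) (by positivity)
    rw [hvol] at h1
    have hsub : Set.Icc (0 : Fin m → ℝ) (fun _ => 1 / ((m : ℝ) + 1)) ⊆
        L '' probSimplex m.succ := by
      intro u hu
      have hsum : ∑ i, u i ≤ 1 := by
        calc ∑ i, u i ≤ ∑ _i : Fin m, 1 / ((m : ℝ) + 1) :=
              Finset.sum_le_sum fun i _ => hu.2 i
          _ ≤ 1 := by
              simp only [Finset.sum_const, Finset.card_univ, Fintype.card_fin, nsmul_eq_mul]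
              rw [mul_one_div, div_le_one (by positivity)]
              linarith
      refine ⟨WithLp.toLp 2 (Fin.cons (1 - ∑ i, u i) u), ⟨?_, ?_⟩, ?_⟩
      · intro i
        refine Fin.cases ?_ (fun j => ?_) i
        · simpa using hsum
        · simpa using hu.1 j
      · simp [Fin.sum_univ_succ]
      · ext i
        rfl
    intro h0
    rw [h0, mul_zero] at h1
    have h2 := le_antisymm ((measure_mono hsub).trans h1) (zero_le)
    rw [Real.volume_Icc_pi] at h2
    rw [Finset.prod_eq_zero_iff] at h2
    obtain ⟨i, -, hi⟩ := h2
    rw [ENNReal.ofReal_eq_zero] at hi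
    have : (0 : ℝ) < 1 / ((m : ℝ) + 1) := by positivity
    simp only [Pi.zero_apply, sub_zero] at hi
    linarith
  · -- the affine chart that restores the first coordinate
    let L : (Fin m → ℝ) →ₗ[ℝ] EuclideanSpace ℝ (Fin m.succ) :=
      { toFun := fun u => WithLp.toLp 2 (Fin.cons (-∑ i, u i) u)
        map_add' := fun u v => by
          ext i
          refine Fin.cases ?_ (fun j => ?_) i
          · simp [Finset.sum_add_distrib]; ring
          · simp
        map_smul' := fun c u => by
          ext i
          refine Fin.cases ?_ (fun j => ?_) i
          · simp [Finset.mul_sum]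
          · simp }
    let b : EuclideanSpace ℝ (Fin m.succ) := WithLp.toLp 2 (Fin.cons 1 0)
    have hL : LipschitzWith ‖L.toContinuousLinearMap‖₊ (fun u => b + L u) := by
      intro u v
      rw [edist_add_left]
      exact L.toContinuousLinearMap.lipschitz u v
    have h1 := (hL.lipschitzOnWith (s := Set.Icc 0 1)).hausdorffMeasure_image_le
      (d := (m : ℝ)) (by positivity)
    rw [hvol] at h1
    have hsub : probSimplex m.succ ⊆ (fun u => b + L u) '' Set.Icc 0 1 := by
      intro v hv
      refine ⟨fun i => v i.succ, ⟨fun i => hv.1 _, fun i => ?_⟩, ?_⟩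
      · have h3 : v i.succ ≤ ∑ j, v j :=
          Finset.single_le_sum (f := fun j => v j) (fun j _ => hv.1 j) (Finset.mem_univ _)
        exact h3.trans hv.2.le
      · have h4 : v 0 + ∑ i : Fin m, v i.succ = 1 := by
          have := hv.2
          rwa [Fin.sum_univ_succ] at this
        ext i
        refine Fin.cases ?_ (fun j => ?_) i
        · simp [b, L]; linarith
        · simp [b, L]
    refine ne_of_lt ((measure_mono hsub).trans_lt (h1.trans_lt ?_))
    refine ENNReal.mul_lt_top ?_ ?_
    · exact ENNReal.rpow_lt_top_of_nonneg (by positivity) ENNReal.coe_ne_top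
    · exact isCompact_Icc.measure_lt_top

/-- A function `f` of the cause (`n` states) and the exogenous variable (`θ` states), with values
in the `n` states of the effect, is generic if every effect `y` can be reached from every cause
`x`, and if, for every `y`, the sets `f_x⁻¹(y)` are different for different `x`. -/
def IsGenericFunction {n θ : ℕ} (f : Fin n → Fin θ → Fin n) : Prop :=
  (∀ x₁ x₂ : Fin n, x₁ ≠ x₂ → ∀ y : Fin n, {e | f x₁ e = y} ≠ {e | f x₂ e = y}) ∧
  ∀ x y : Fin n, {e | f x e = y}.Nonempty

/-- The joint distribution of the pair `(C, f (C, E))`, where the cause `C` and the exogenous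
variable `E` are independent with distributions `c` and `e`. -/
def causeEffectJoint {n θ : ℕ} (f : Fin n → Fin θ → Fin n) (c : Fin n → ℝ) (e : Fin θ → ℝ)
    (i j : Fin n) : ℝ :=
  ∑ s : Fin n × Fin θ, if s.1 = i ∧ f s.1 s.2 = j then c s.1 * e s.2 else 0

/-- The two possible causal directions between the observed variables `X` and `Y`. -/
inductive CausalDirection
  | XtoY
  | YtoX

/-- The joint distribution `p(x, y)` of the observed pair `(X, Y)`: if the true direction is
`X → Y`, then `X` has distribution `c` and `Y = f (X, E)`; if it is `Y → X`, then `Y` has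
distribution `c` and `X = f (Y, E)`. -/
def observedJoint {n θ : ℕ} (d : CausalDirection) (f : Fin n → Fin θ → Fin n)
    (c : Fin n → ℝ) (e : Fin θ → ℝ) (x y : Fin n) : ℝ :=
  match d with
  | .XtoY => causeEffectJoint f c e x y
  | .YtoX => causeEffectJoint f c e y x

/-- The conditional distributions `P(Y = y | X = x)`, as a family indexed by `x`. -/
def condYGivenX {n : ℕ} (p : Fin n → Fin n → ℝ) (x y : Fin n) : ℝ :=
  p x y / ∑ y', p x y'

/-- The conditional distributions `P(X = x | Y = y)`, as a family indexed by `y`. -/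
def condXGivenY {n : ℕ} (p : Fin n → Fin n → ℝ) (y x : Fin n) : ℝ :=
  p x y / ∑ x', p x' y

/-- A candidate answer of the algorithm: a variable `E` with `card` states and distribution
`prob`, together with `n` functions of `E` with values in `n` states. -/
structure ExogenousVariable (n : ℕ) where
  card : ℕ
  prob : Fin card → ℝ
  func : Fin n → Fin card → Fin n

/-- `E` explains the distributions `Z 0, …, Z (n - 1)`: `prob` is a probability distribution and
`func i (E)` has distribution `Z i` for every `i`. -/
def ExogenousVariable.Explains {n : ℕ} (E : ExogenousVariable n) (Z : Fin n → Fin n → ℝ) : Prop :=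
  E.prob ∈ stdSimplex ℝ (Fin E.card) ∧
  ∀ i j, (∑ k, if E.func i k = j then E.prob k else 0) = Z i j

/-- `A` maps every family of `n` probability distributions on `n` states to a variable of minimum
cardinality, with functions, that explains the family. Nothing is required of `A` on inputs that
are not families of probability distributions. -/
def FindsMinCardinality {n : ℕ} (A : (Fin n → Fin n → ℝ) → ExogenousVariable n) : Prop :=
  ∀ Z : Fin n → Fin n → ℝ, (∀ i, Z i ∈ stdSimplex ℝ (Fin n)) →
    (A Z).Explains Z ∧ ∀ E : ExogenousVariable n, E.Explains Z → (A Z).card ≤ E.card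

/-- The decision rule: run `A` on the conditional distributions of `Y` given `X` and of `X` given
`Y`, and declare the direction whose exogenous variable has strictly smaller cardinality. There is
no decision (`none`) if the cardinalities agree. -/
def inferDirection {n : ℕ} (A : (Fin n → Fin n → ℝ) → ExogenousVariable n)
    (p : Fin n → Fin n → ℝ) : Option CausalDirection :=
  if (A (condYGivenX p)).card < (A (condXGivenY p)).card then some .XtoY
  else if (A (condXGivenY p)).card < (A (condYGivenX p)).card then some .YtoX
  else none

end

/-! In the causal direction `E₀` itself explains the conditionals, so the minimum is at most `θ < n
* (n - 1)`. In the other direction almost surely no variable with fewer than `n * (n - 1)` states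
works. Fix `m < n * (n - 1)` and functions `g`. The families explained through `g` lie in the span
of `m` vectors of an `n²`-dimensional space; as `m + n < n²`, they satisfy a linear relation that
does not follow from normalization (`exists_annihilating_coefficients`). Clearing denominators in
the conditionals turns it into a polynomial in the distributions of cause and exogenous variable.
This polynomial is not identically zero on the product of the affine hulls of the simplices:
genericity gives signed weights for which one marginal vanishes and a single term survives
(`exists_marginal_eq_zero`). Its zeros are therefore null, and there are only finitely many pairs
`(m, g)`. -/

/-! ### Zero sets of polynomials on the simplex -/

/-- The zero set of a nonzero real polynomial in finitely many variables is a null set. -/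
theorem MvPolynomial.ae_eval_ne_zero {m : ℕ} (p : MvPolynomial (Fin m) ℝ) (hp : p ≠ 0) :
    ∀ᵐ u : Fin m → ℝ, MvPolynomial.eval u p ≠ 0 := by
  induction m with
  | zero =>
    refine Filter.Eventually.of_forall fun u hu => hp ?_
    refine MvPolynomial.funext fun v => ?_
    rw [Subsingleton.elim v u, hu, map_zero]
  | succ m ih =>
    have hq : MvPolynomial.finSuccEquiv ℝ m p ≠ 0 := by simpa using hp
    -- View `p` as a polynomial in the variable 0 over the others. Where its `k`-th coefficient is
    -- nonzero, which is almost everywhere, the slice has finitely many roots; Fubini concludes.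
    obtain ⟨k, hk⟩ : ∃ k, (MvPolynomial.finSuccEquiv ℝ m p).coeff k ≠ 0 := by
      by_contra! h
      exact hq (Polynomial.ext fun k => by simpa using h k)
    have hvp := (volume_preserving_piFinSuccAbove (fun _ : Fin (m + 1) => ℝ) 0).symm
    have hmeas : MeasurableSet {u : Fin (m + 1) → ℝ | MvPolynomial.eval u p ≠ 0} :=
      (isOpen_ne_fun (MvPolynomial.continuous_eval p) continuous_const).measurableSet
    rw [← hvp.map_eq, ae_map_iff hvp.measurable.aemeasurable hmeas, Measure.volume_eq_prod,
      Measure.ae_prod_iff_ae_ae, Measure.ae_ae_comm]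
    · filter_upwards [ih _ hk] with y hy
      have hne : (Polynomial.map (MvPolynomial.eval y) (MvPolynomial.finSuccEquiv ℝ m p)) ≠ 0 := by
        intro h0
        apply hy
        rw [← Polynomial.coeff_map, h0, Polynomial.coeff_zero]
      have hfin := (Polynomial.finite_setOfPred_isRoot hne)
      have := hfin.measure_zero (volume : Measure ℝ)
      rw [ae_iff]
      refine measure_mono_null (fun x hx => ?_) this
      simp only [ne_eq, not_not, Set.mem_ofPred_eq] at hx ⊢
      rw [Polynomial.IsRoot, ← MvPolynomial.eval_eq_eval_mv_eval']
      simpa [MeasurableEquiv.piFinSuccAbove, Fin.insertNthEquiv] using hx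
    · exact hvp.measurable hmeas
    · exact hvp.measurable hmeas

/-- A polynomial that does not vanish identically on the affine span of the simplex is almost
surely nonzero at a uniformly distributed point of the simplex. -/
theorem uniformSimplex_ae_eval_ne_zero {n : ℕ} (p : MvPolynomial (Fin n) ℝ) (x : Fin n → ℝ)
    (hx : ∑ i, x i = 1) (hp : MvPolynomial.eval x p ≠ 0) :
    ∀ᵐ v ∂uniformSimplex n, MvPolynomial.eval (fun i => v i) p ≠ 0 := by
  obtain _ | m := n
  · simp at hx
  have hd : (((m + 1) : ℕ) : ℝ) - 1 = (m : ℝ) := by push_cast; ring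
  have hvol : (Measure.hausdorffMeasure (m : ℝ) : Measure (Fin m → ℝ)) = volume := by
    simpa using hausdorffMeasure_pi_real (ι := Fin m)
  have hsimplex : MeasurableSet (probSimplex (m + 1)) :=
    ((isClosed_stdSimplex (𝕜 := ℝ) (ι := Fin (m + 1))).preimage (by fun_prop)).measurableSet
  let L : (Fin m → ℝ) →ₗ[ℝ] EuclideanSpace ℝ (Fin (m + 1)) :=
    { toFun := fun u => WithLp.toLp 2 (Fin.cons (-∑ i, u i) u)
      map_add' := fun u v => by
        ext i
        refine Fin.cases ?_ (fun j => ?_) i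
        · simp [Finset.sum_add_distrib]; ring
        · simp
      map_smul' := fun c u => by
        ext i
        refine Fin.cases ?_ (fun j => ?_) i
        · simp [Finset.mul_sum]
        · simp }
  let b : EuclideanSpace ℝ (Fin (m + 1)) := WithLp.toLp 2 (Fin.cons 1 0)
  have hL : LipschitzWith ‖L.toContinuousLinearMap‖₊ (fun u => b + L u) := by
    intro u v
    rw [edist_add_left]
    exact L.toContinuousLinearMap.lipschitz u v
  have hchart : ∀ v : EuclideanSpace ℝ (Fin (m + 1)), ∑ i, v i = 1 →
      b + L (fun i => v i.succ) = v := by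
    intro v hv
    rw [Fin.sum_univ_succ] at hv
    ext i
    refine Fin.cases ?_ (fun j => ?_) i
    · simp [b, L]; linarith
    · simp [b, L]
  -- Substituting `s` pulls `p` back along the affine chart `u ↦ b + L u` of the hyperplane of
  -- coordinate sum 1.
  let s : Fin (m + 1) → MvPolynomial (Fin m) ℝ :=
    Fin.cons (1 - ∑ i, MvPolynomial.X i) MvPolynomial.X
  have hs : ∀ u : Fin m → ℝ, MvPolynomial.eval u (MvPolynomial.bind₁ s p) =
      MvPolynomial.eval (fun i => (b + L u) i) p := by
    intro u
    rw [← MvPolynomial.aeval_eq_eval, MvPolynomial.aeval_bind₁, MvPolynomial.aeval_eq_eval]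
    congr 1
    congr 1
    funext i
    refine Fin.cases ?_ (fun j => ?_) i
    · simp [b, L, s, sub_eq_add_neg]
    · simp [b, L, s]
  have hne : MvPolynomial.bind₁ s p ≠ 0 := by
    intro h0
    have h1 := hs (fun i => x i.succ)
    have h2 := hchart (WithLp.toLp 2 x) hx
    simp only at h2
    rw [h0, map_zero, h2] at h1
    exact hp h1.symm
  have hnull := MvPolynomial.ae_eval_ne_zero _ hne
  rw [ae_iff] at hnull
  simp only [hs, ne_eq, not_not] at hnull
  -- A Lipschitz map sends Lebesgue-null sets of `ℝᵐ` to null sets of `m`-dimensional Hausdorff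
  -- measure.
  have h1 := (hL.lipschitzOnWith
    (s := {u | MvPolynomial.eval (fun i => (b + L u) i) p = 0})).hausdorffMeasure_image_le
      (d := (m : ℝ)) (by positivity)
  rw [hvol, hnull, mul_zero, nonpos_iff_eq_zero] at h1
  unfold uniformSimplex
  rw [hd]
  have hac := ProbabilityTheory.ae_cond_of_forall_mem
    (μ := Measure.hausdorffMeasure (m : ℝ)) hsimplex (p := (· ∈ probSimplex (m + 1))) fun _ h => h
  have hae : ∀ᵐ v ∂(Measure.hausdorffMeasure (m : ℝ) : Measure (EuclideanSpace ℝ (Fin (m + 1)))),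
      v ∉ (fun u => b + L u) '' {u | MvPolynomial.eval (fun i => (b + L u) i) p = 0} :=
    measure_eq_zero_iff_ae_notMem.1 h1
  filter_upwards [hac, ProbabilityTheory.cond_absolutelyContinuous.ae_le hae] with v hv hv' h0
  refine hv' ⟨fun i => v i.succ, ?_, hchart v hv.2⟩
  rw [Set.mem_ofPred_eq, hchart v hv.2]
  exact h0

/-- Almost every point of the simplex has only positive coordinates. -/
theorem uniformSimplex_ae_pos (n : ℕ) :
    ∀ᵐ v ∂uniformSimplex n, (∑ i, v i = 1) ∧ ∀ i, 0 < v i := by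
  have hsimplex : MeasurableSet (probSimplex n) :=
    ((isClosed_stdSimplex (𝕜 := ℝ) (ι := Fin n)).preimage (by fun_prop)).measurableSet
  have hmem : ∀ᵐ v ∂uniformSimplex n, v ∈ probSimplex n :=
    ProbabilityTheory.ae_cond_of_forall_mem hsimplex fun _ h => h
  have hne : ∀ᵐ v ∂uniformSimplex n, ∀ i, v i ≠ 0 := by
    rw [ae_all_iff]
    intro i
    have := uniformSimplex_ae_eval_ne_zero (MvPolynomial.X i) (Pi.single i (1 : ℝ)) (by simp)
      (by simp)
    simpa using this
  filter_upwards [hmem, hne] with v hv hv'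
  exact ⟨hv.2, fun i => lt_of_le_of_ne (hv.1 i) (hv' i).symm⟩

/-! ### Nonvanishing of the cleared relations -/

/-- The probability that the cause `i` produces the effect `j`, if the exogenous variable has
distribution `e`. -/
noncomputable def effectProb {n θ : ℕ} (f : Fin n → Fin θ → Fin n) (e : Fin θ → ℝ)
    (i j : Fin n) : ℝ :=
  ∑ k, if f i k = j then e k else 0

/-- The numerator, over the common denominator, of the linear combination with coefficients `a`
of the conditional probabilities of the cause given the effect. -/
noncomputable def clearedRelation {n θ : ℕ} (f : Fin n → Fin θ → Fin n) (a : Fin n → Fin n → ℝ)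
    (c : Fin n → ℝ) (e : Fin θ → ℝ) : ℝ :=
  ∑ j, (∑ i, a j i * (c i * effectProb f e i j)) *
    ∏ j' ∈ Finset.univ.erase j, ∑ i, c i * effectProb f e i j'

section

variable {n θ : ℕ} {f : Fin n → Fin θ → Fin n} {c : Fin n → ℝ} {e : Fin θ → ℝ}

theorem effectProb_mul (r : ℝ) (i j : Fin n) :
    effectProb f (fun k => r * e k) i j = r * effectProb f e i j := by
  simp [effectProb, Finset.mul_sum]

theorem le_effectProb (he : ∀ k, 0 ≤ e k) {i j : Fin n} {k : Fin θ} (hk : f i k = j) :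
    e k ≤ effectProb f e i j := by
  have := Finset.single_le_sum (f := fun k => if f i k = j then e k else 0) (s := Finset.univ)
    (fun k _ => by split_ifs; exacts [he k, le_rfl]) (Finset.mem_univ k)
  simpa [hk, effectProb] using this

theorem effectProb_pos (hf : IsGenericFunction f) (he : ∀ k, 0 < e k) (i j : Fin n) :
    0 < effectProb f e i j := by
  obtain ⟨k, hk⟩ := hf.2 i j
  exact (he k).trans_le (le_effectProb (fun k => (he k).le) hk)

theorem sum_effectProb (i : Fin n) : ∑ j, effectProb f e i j = ∑ k, e k := by
  unfold effectProb
  rw [Finset.sum_comm]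
  simp

theorem causeEffectJoint_eq (i j : Fin n) :
    causeEffectJoint f c e i j = c i * effectProb f e i j := by
  unfold causeEffectJoint effectProb
  rw [Fintype.sum_prod_type, Finset.sum_eq_single i]
  · simp [Finset.mul_sum]
  · intro i' _ hi'
    simp [hi']
  · simp

/-- For a generic function there are weights, not necessarily positive, at which the marginal of
one effect vanishes and neither the marginals of the other effects nor a given nonconstant
combination of the joint probabilities of that effect do. -/
theorem IsGenericFunction.exists_marginal_eq_zero (hf : IsGenericFunction f) (j₀ i₁ i₂ : Fin n)
    (a : Fin n → ℝ) (ha : a i₁ ≠ a i₂) :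
    ∃ (c : Fin n → ℝ) (e : Fin θ → ℝ), ∑ i, c i = 1 ∧ ∑ k, e k = 1 ∧
      ∑ i, c i * effectProb f e i j₀ = 0 ∧
      (∀ j, j ≠ j₀ → ∑ i, c i * effectProb f e i j ≠ 0) ∧
      ∑ i, a i * (c i * effectProb f e i j₀) ≠ 0 := by
  have hi : i₁ ≠ i₂ := fun h => ha (h ▸ rfl)
  obtain ⟨k, hk⟩ : ∃ k, ¬ (f i₁ k = j₀ ↔ f i₂ k = j₀) := by
    by_contra! h
    exact hf.1 i₁ i₂ hi j₀ (Set.ext h)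
  wlog hk' : f i₁ k = j₀ ∧ f i₂ k ≠ j₀ generalizing i₁ i₂
  · exact this i₂ i₁ ha.symm hi.symm (fun h => hk h.symm) (by tauto)
  obtain ⟨hk₁, hk₂⟩ := hk'
  have hθ : (1 : ℝ) ≤ θ := by
    have : 0 < θ := k.pos
    exact_mod_cast this
  -- A heavy weight at `k`, which separates `i₁` from `i₂`. The bound `t > θ` forces `w₁ ≠ w₂`; the
  -- bound `t > θ²` keeps the other marginals nonzero.
  let t : ℝ := θ ^ 2 + 1
  let e : Fin θ → ℝ := fun x => if x = k then t else 1
  have ht : 1 ≤ t := le_add_of_nonneg_left (sq_nonneg _)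
  have he1 : ∀ x, 1 ≤ e x := fun x => by
    dsimp only [e]; split_ifs; exacts [ht, le_rfl]
  have he0 : ∀ x, 0 ≤ e x := fun x => zero_le_one.trans (he1 x)
  have hge : ∀ i j, 1 ≤ effectProb f e i j := fun i j => by
    obtain ⟨x, hx⟩ := hf.2 i j
    exact (he1 x).trans (le_effectProb he0 hx)
  have hle : ∀ i j, f i k ≠ j → effectProb f e i j ≤ θ := fun i j hij => by
    calc effectProb f e i j ≤ ∑ _x : Fin θ, (1 : ℝ) := by
          refine Finset.sum_le_sum fun x _ => ?_
          by_cases hx : x = k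
          · simp [hx, hij]
          · simp only [e, hx, if_false]
            split_ifs <;> norm_num
      _ = θ := by simp
  have hw₁ : t ≤ effectProb f e i₁ j₀ := by
    simpa [e] using le_effectProb he0 hk₁
  have hw₂ := hle i₂ j₀ hk₂
  set w₁ := effectProb f e i₁ j₀ with hw₁def
  set w₂ := effectProb f e i₂ j₀ with hw₂def
  have hw₂1 : 1 ≤ w₂ := hge i₂ j₀
  have hlt : w₂ - w₁ ≠ 0 := by
    have : (θ : ℝ) < t := by simp only [t]; nlinarith
    linarith
  have hS : ∑ x, e x ≠ 0 := by
    have := Finset.single_le_sum (f := e) (fun x _ => he0 x) (Finset.mem_univ k)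
    linarith [he1 k]
  set r := (∑ x, e x)⁻¹ with hr
  have hr0 : r ≠ 0 := inv_ne_zero hS
  have hl0 : (w₂ - w₁)⁻¹ ≠ 0 := inv_ne_zero hlt
  set l := (w₂ - w₁)⁻¹ with hl
  -- Weights proportional to `(w₂, -w₁)` on `(i₁, i₂)` cancel the marginal of `j₀`. One is negative,
  -- which is harmless since only a point of the affine hull is needed.
  let c : Fin n → ℝ := fun i => l * ((if i = i₁ then w₂ else 0) - if i = i₂ then w₁ else 0)
  have hc : ∀ g : Fin n → ℝ, ∑ i, c i * g i = l * (w₂ * g i₁ - w₁ * g i₂) := fun g => by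
    simp only [c, mul_assoc, sub_mul, ite_mul, zero_mul, ← Finset.mul_sum,
      Finset.sum_sub_distrib, Finset.sum_ite_eq', Finset.mem_univ, if_true]
  refine ⟨c, fun x => r * e x, ?_, ?_, ?_, fun j hj => ?_, ?_⟩
  · have := hc 1
    simp only [Pi.one_apply, mul_one] at this
    rw [this, hl, inv_mul_cancel₀ hlt]
  · rw [← Finset.mul_sum, hr, inv_mul_cancel₀ hS]
  · simp only [effectProb_mul]
    rw [hc]
    ring
  · simp only [effectProb_mul]
    rw [hc]
    have h1 := hle i₁ j (by rw [hk₁]; exact hj.symm)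
    have h2 := hge i₂ j
    have h3 := hge i₁ j
    have : w₂ * effectProb f e i₁ j - w₁ * effectProb f e i₂ j < 0 := by
      have h4 : w₂ * effectProb f e i₁ j ≤ θ * θ := by gcongr
      have h5 : t * 1 ≤ w₁ * effectProb f e i₂ j := by gcongr; linarith
      simp only [t] at h5
      linarith
    have h6 := mul_ne_zero (mul_ne_zero hl0 hr0) this.ne
    convert h6 using 1
    ring
  · have : ∑ i, a i * (c i * effectProb f (fun x => r * e x) i j₀) =
        ∑ i, c i * (a i * (r * effectProb f e i j₀)) :=
      Finset.sum_congr rfl fun i _ => by rw [effectProb_mul]; ring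
    rw [this, hc, ← hw₁def, ← hw₂def]
    have h6 : l * r * (w₁ * w₂) * (a i₁ - a i₂) ≠ 0 :=
      mul_ne_zero (mul_ne_zero (mul_ne_zero hl0 hr0)
        (mul_ne_zero (by linarith) (by linarith))) (sub_ne_zero.2 ha)
    convert h6 using 1
    ring

/-- A linear relation between the conditional probabilities of the cause given the effect that is
not a combination of the normalizations does not hold identically. -/
theorem IsGenericFunction.exists_clearedRelation_ne_zero (hf : IsGenericFunction f)
    (a : Fin n → Fin n → ℝ) (ha : ∃ j i₁ i₂, a j i₁ ≠ a j i₂) :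
    ∃ (c : Fin n → ℝ) (e : Fin θ → ℝ), ∑ i, c i = 1 ∧ ∑ k, e k = 1 ∧
      clearedRelation f a c e ≠ 0 := by
  obtain ⟨j₀, i₁, i₂, h⟩ := ha
  obtain ⟨c, e, hc, he, h0, hne, hA⟩ := hf.exists_marginal_eq_zero j₀ i₁ i₂ (a j₀) h
  refine ⟨c, e, hc, he, ?_⟩
  unfold clearedRelation
  -- Every term with `j ≠ j₀` contains the vanishing marginal of `j₀` as a factor.
  rw [Finset.sum_eq_single j₀]
  · exact mul_ne_zero hA
      (Finset.prod_ne_zero_iff.2 fun j hj => hne j (Finset.ne_of_mem_erase hj))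
  · intro j _ hj
    rw [Finset.prod_eq_zero (i := j₀) (by simp [hj.symm]) h0, mul_zero]
  · simp

open MvPolynomial in
theorem exists_eval_eq_clearedRelation_left (a : Fin n → Fin n → ℝ) (e : Fin θ → ℝ) :
    ∃ p : MvPolynomial (Fin n) ℝ, ∀ c, eval c p = clearedRelation f a c e :=
  ⟨∑ j, (∑ i, C (a j i) * (X i * C (effectProb f e i j))) *
    ∏ j' ∈ Finset.univ.erase j, ∑ i, X i * C (effectProb f e i j'), fun c => by
      simp [clearedRelation]⟩

open MvPolynomial in
theorem exists_eval_eq_clearedRelation_right (a : Fin n → Fin n → ℝ) (c : Fin n → ℝ) :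
    ∃ p : MvPolynomial (Fin θ) ℝ, ∀ e, eval e p = clearedRelation f a c e := by
  let w : Fin n → Fin n → MvPolynomial (Fin θ) ℝ := fun i j => ∑ k, if f i k = j then X k else 0
  have hw : ∀ e i j, eval e (w i j) = effectProb f e i j := fun e i j => by
    simp only [w, effectProb, map_sum]
    refine Finset.sum_congr rfl fun k _ => ?_
    split_ifs <;> simp
  exact ⟨∑ j, (∑ i, C (a j i) * (C (c i) * w i j)) *
    ∏ j' ∈ Finset.univ.erase j, ∑ i, C (c i) * w i j', fun e => by
      simp [clearedRelation, hw]⟩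

/-- The expression is polynomial in each argument separately. From a witness `(c₀, e₀)`, almost
every `c` is good together with `e₀`, and for each such `c` almost every `e` is good. -/
theorem IsGenericFunction.ae_clearedRelation_ne_zero (hf : IsGenericFunction f)
    (a : Fin n → Fin n → ℝ) (ha : ∃ j i₁ i₂, a j i₁ ≠ a j i₂) :
    ∀ᵐ ce ∂((uniformSimplex n).prod (uniformSimplex θ)),
      clearedRelation f a (fun i => ce.1 i) (fun k => ce.2 k) ≠ 0 := by
  obtain ⟨c₀, e₀, hc₀, he₀, hne⟩ := hf.exists_clearedRelation_ne_zero a ha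
  have hθ : θ ≠ 0 := by
    rintro rfl
    simp at he₀
  have := uniformSimplex_isProbabilityMeasure θ hθ
  have hmeas : MeasurableSet {ce : EuclideanSpace ℝ (Fin n) × EuclideanSpace ℝ (Fin θ) |
      clearedRelation f a (fun i => ce.1 i) (fun k => ce.2 k) ≠ 0} := by
    refine (isOpen_ne_fun ?_ continuous_const).measurableSet
    unfold clearedRelation effectProb
    have (i j : Fin n) : Continuous fun ce : EuclideanSpace ℝ (Fin n) × EuclideanSpace ℝ (Fin θ) =>
        ∑ k, if f i k = j then ce.2 k else 0 :=
      continuous_finsetSum _ fun k _ => by split_ifs <;> fun_prop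
    fun_prop
  rw [Measure.ae_prod_iff_ae_ae hmeas]
  obtain ⟨p, hp⟩ := exists_eval_eq_clearedRelation_left (f := f) a e₀
  filter_upwards [uniformSimplex_ae_eval_ne_zero p c₀ hc₀ (by rwa [hp])] with c hc
  obtain ⟨q, hq⟩ := exists_eval_eq_clearedRelation_right (f := f) a (fun i => c i)
  filter_upwards [uniformSimplex_ae_eval_ne_zero q e₀ he₀ (by rwa [hq, ← hp])] with e he
  rwa [← hq]

end

/-! ### Lower bound in the anticausal direction -/

/-- Fewer than `n (n - 1)` assignments of a state to each of `n` indices satisfy a common linear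
relation that is not constant in the state. -/
theorem exists_annihilating_coefficients {n m : ℕ} (hm : m < n * (n - 1))
    (g : Fin n → Fin m → Fin n) :
    ∃ a : Fin n → Fin n → ℝ, (∀ k, ∑ j, a j (g j k) = 0) ∧ ∃ j i₁ i₂, a j i₁ ≠ a j i₂ := by
  obtain _ | n := n
  · simp at hm
  -- Prescribing `a j 0 = 0` excludes the relations constant in the state, so any nonzero kernel
  -- element is nonconstant. The kernel is nontrivial because `m + (n + 1) < (n + 1)²`.
  let T : (Fin (n + 1) → Fin (n + 1) → ℝ) →ₗ[ℝ] (Fin m → ℝ) × (Fin (n + 1) → ℝ) :=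
    { toFun := fun a => (fun k => ∑ j, a j (g j k), fun j => a j 0)
      map_add' := fun a b => by ext <;> simp [Finset.sum_add_distrib]
      map_smul' := fun r a => by ext <;> simp [Finset.mul_sum] }
  have hker : T.ker ≠ ⊥ := by
    apply LinearMap.ker_ne_bot_of_finrank_lt
    simp only [Module.finrank_prod, Module.finrank_pi_fintype, Module.finrank_self,
      Finset.sum_const, Finset.card_univ, Fintype.card_fin, smul_eq_mul, mul_one]
    simp only [Nat.add_sub_cancel] at hm
    linarith
  obtain ⟨a, haT, ha0⟩ := (Submodule.ne_bot_iff _).1 hker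
  have haT' : T a = 0 := haT
  have h1 : ∀ k, ∑ j, a j (g j k) = 0 := fun k => congrFun (congrArg Prod.fst haT') k
  have h2 : ∀ j, a j 0 = 0 := fun j => congrFun (congrArg Prod.snd haT') j
  refine ⟨a, h1, ?_⟩
  by_contra! h
  exact ha0 (funext fun j => funext fun i => (h j i 0).trans (h2 j))

/-- A variable that explains a family satisfies the linear relations of its functions. -/
theorem ExogenousVariable.Explains.sum_mul_eq_zero {n : ℕ} {E : ExogenousVariable n}
    {Z : Fin n → Fin n → ℝ} (hE : E.Explains Z) (a : Fin n → Fin n → ℝ)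
    (ha : ∀ k, ∑ j, a j (E.func j k) = 0) : ∑ j, ∑ i, a j i * Z j i = 0 := by
  calc ∑ j, ∑ i, a j i * Z j i
      = ∑ j, ∑ k, a j (E.func j k) * E.prob k := by
        refine Finset.sum_congr rfl fun j _ => ?_
        simp_rw [← hE.2, Finset.mul_sum]
        rw [Finset.sum_comm]
        simp
    _ = ∑ k, (∑ j, a j (E.func j k)) * E.prob k := by
        rw [Finset.sum_comm]
        simp_rw [Finset.sum_mul]
    _ = 0 := by simp [ha]

/-- Almost surely, the conditional distributions of the cause given the effect are not explained
by a variable with fewer than `n (n - 1)` states. -/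
theorem IsGenericFunction.ae_le_card_of_explains {n θ : ℕ} {f : Fin n → Fin θ → Fin n}
    (hf : IsGenericFunction f) :
    ∀ᵐ ce ∂((uniformSimplex n).prod (uniformSimplex θ)),
      (∀ i, 0 < ce.1 i) → (∀ k, 0 < ce.2 k) → ∀ E : ExogenousVariable n,
        E.Explains (condXGivenY (causeEffectJoint f (fun i => ce.1 i) fun k => ce.2 k)) →
          n * (n - 1) ≤ E.card := by
  -- The coefficients depend only on `m` and the functions, not on the distributions, so finitely
  -- many null sets are discarded.
  choose! a ha hne using
    fun (m : ℕ) (hm : m < n * (n - 1)) => exists_annihilating_coefficients (m := m) hm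
  have hae : ∀ᵐ ce ∂((uniformSimplex n).prod (uniformSimplex θ)),
      ∀ (m : Fin (n * (n - 1))) (g : Fin n → Fin m → Fin n),
        clearedRelation f (a m g) (fun i => ce.1 i) (fun k => ce.2 k) ≠ 0 := by
    rw [ae_all_iff]
    intro m
    rw [ae_all_iff]
    exact fun g => hf.ae_clearedRelation_ne_zero _ (hne m m.2 g)
  filter_upwards [hae] with ce hce hc he E hE
  by_contra! hlt
  apply hce ⟨E.card, hlt⟩ E.func
  have hrel := hE.sum_mul_eq_zero _ (ha _ hlt E.func)
  simp only [condXGivenY, causeEffectJoint_eq] at hrel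
  have hq : ∀ j, ∑ i, ce.1 i * effectProb f (fun k => ce.2 k) i j ≠ 0 := fun j => by
    have hj : Finset.univ.Nonempty := ⟨j, Finset.mem_univ j⟩
    exact (Finset.sum_pos (fun i _ => mul_pos (hc i) (effectProb_pos hf he i j)) hj).ne'
  -- Multiplying by all the marginals, which are positive, turns the relation into
  -- `clearedRelation`.
  have hprod := congrArg
    (· * ∏ j, ∑ i, ce.1 i * effectProb f (fun k => ce.2 k) i j) hrel
  simp only [zero_mul, Finset.sum_mul] at hprod
  rw [← hprod]
  refine Finset.sum_congr rfl fun j _ => ?_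
  rw [← Finset.mul_prod_erase _ _ (Finset.mem_univ j), Finset.sum_mul]
  refine Finset.sum_congr rfl fun i _ => ?_
  field_simp [hq j]

/-! ### Comparison of the two directions -/

/-- For positive cause probabilities, the conditional distributions of the effect given the cause
are those of the values of the mechanism. -/
theorem condYGivenX_causeEffectJoint {n θ : ℕ} {f : Fin n → Fin θ → Fin n} {c : Fin n → ℝ}
    {e : Fin θ → ℝ} (hc : ∀ i, c i ≠ 0) (he : ∑ k, e k = 1) :
    condYGivenX (causeEffectJoint f c e) = effectProb f e := by
  ext i j
  simp only [condYGivenX, causeEffectJoint_eq]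
  rw [← Finset.mul_sum, sum_effectProb, he, mul_one, mul_div_cancel_left₀ _ (hc i)]

theorem FindsMinCardinality.ae_card_lt_card {n θ : ℕ} (hθ : θ < n * (n - 1))
    {f : Fin n → Fin θ → Fin n} (hf : IsGenericFunction f)
    {A : (Fin n → Fin n → ℝ) → ExogenousVariable n} (hA : FindsMinCardinality A) :
    ∀ᵐ ce ∂((uniformSimplex n).prod (uniformSimplex θ)),
      (A (condYGivenX (causeEffectJoint f (fun i => ce.1 i) fun k => ce.2 k))).card <
        (A (condXGivenY (causeEffectJoint f (fun i => ce.1 i) fun k => ce.2 k))).card := by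
  have hn : n ≠ 0 := by
    rintro rfl
    simp at hθ
  have hθ0 : θ ≠ 0 := by
    rintro rfl
    obtain ⟨k, -⟩ := hf.2 ⟨0, hn.bot_lt⟩ ⟨0, hn.bot_lt⟩
    exact k.elim0
  have := uniformSimplex_isProbabilityMeasure n hn
  have := uniformSimplex_isProbabilityMeasure θ hθ0
  filter_upwards [Measure.quasiMeasurePreserving_fst.ae (uniformSimplex_ae_pos n),
    Measure.quasiMeasurePreserving_snd.ae (uniformSimplex_ae_pos θ),
    hf.ae_le_card_of_explains] with ce hc he hlower
  have hprob := effectProb_pos hf he.2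
  -- The true exogenous variable with mechanism `f` competes in the causal direction, which gives
  -- the bound `θ`.
  refine lt_of_le_of_lt (b := θ) ?_ (hθ.trans_le ?_)
  · rw [condYGivenX_causeEffectJoint (fun i => (hc.2 i).ne') he.1]
    refine (hA (effectProb f fun k => ce.2 k) fun i => ⟨fun j => (hprob i j).le, ?_⟩).2
      ⟨θ, fun k => ce.2 k, f⟩ ⟨⟨fun k => (he.2 k).le, he.1⟩, fun i j => rfl⟩
    rw [sum_effectProb, he.1]
  · refine hlower hc.2 he.2 _ (hA _ fun j => ?_).1
    have hpos : ∀ i, 0 < ce.1 i * effectProb f (fun k => ce.2 k) i j :=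
      fun i => mul_pos (hc.2 i) (hprob i j)
    have hsum : 0 < ∑ i, ce.1 i * effectProb f (fun k => ce.2 k) i j :=
      Finset.sum_pos (fun i _ => hpos i) ⟨j, Finset.mem_univ j⟩
    refine ⟨fun i => ?_, ?_⟩ <;> simp only [condXGivenY, causeEffectJoint_eq]
    · exact (div_pos (hpos i) hsum).le
    · rw [← Finset.sum_div, div_self hsum.ne']

theorem corollary1 (n θ : ℕ) (hθ : θ < n * (n - 1))
    (f : Fin n → Fin θ → Fin n) (hf : IsGenericFunction f)
    (A : (Fin n → Fin n → ℝ) → ExogenousVariable n) (hA : FindsMinCardinality A)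
    (d : CausalDirection) :
    ∀ᵐ ce ∂((uniformSimplex n).prod (uniformSimplex θ)),
      inferDirection A (observedJoint d f (fun i => ce.1 i) (fun k => ce.2 k)) = some d := by
  filter_upwards [hA.ae_card_lt_card hθ hf] with ce h
  cases d with
  | XtoY => exact if_pos h
  -- Transposing the joint distribution interchanges the two families of conditionals
  -- definitionally.
  | YtoX => exact (if_neg h.le.not_gt).trans (if_pos h)
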